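/- Let $(M,\varphi,\xi,\eta,g)$ be a (non-empty, smooth) almost contact B-metric manifold of dimension $2n+1$, $n\ge 1$: $g$ is a pseudo-Riemannian metric of signature $(n+1,n)$, $\varphi$ an endomorphism of $TM$, $\xi$ a vector field and $\eta$ a 1-form, all smooth, with $$\varphi\xi=0,\quad \varphi^2=-\mathrm{Id}+\eta\otimes\xi,\quad \eta\circ\varphi=0,\quad \eta(\xi)=1,\quad g(\varphi x,\varphi y)=-g(x,y)+\eta(x)\eta(y).$$ Let $\nabla$ be the Levi-Civita connection of $g$, let $R(x,y)z=\nabla_x\nabla_yz-\nabla_y\nabla_xz-\nabla_{[x,y]}z$ be its curvature, $\rho(y,z)=\operatorname{tr}(x\mapsto R(x,y)z)$ its Ricci tensor, $\tau=g^{ij}\rho(e_i,e_j)$ its scalar curvature and $Q$ its Ricci operator, $g(Qx,y)=\rho(x,y)$. Let $\tilde g(x,y)=g(x,\varphi y)+\eta(x)\eta(y)$ be the associated metric, and let $\operatorname{Div}Q=g^{ij}(\nabla_{e_i}Q)e_j$ and $\operatorname{Div}^*Q=\tilde g^{ij}(\nabla_{e_i}Q)e_j$ be the divergences of $Q$ with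 respect to $g$ and $\tilde g$ (the traces of $\nabla Q$ with respect to these two metrics). Assume that $M$ is Sasaki-like, i.e. $(\nabla_x\varphi)y=-g(x,y)\xi-\eta(y)x+2\eta(x)\eta(y)\xi$, and Einstein-like with constants $(a,b,c)$, i.e. $\rho=a\,g+b\,\tilde g+c\,\eta\otimes\eta$ for real constants $a,b,c$. Call $M$ $\eta$-Einstein if $\rho=a'g+c'\,\eta\otimes\eta$ for some real constants $a',c'$, and Einstein if $\rho=a'g$ for some real constant $a'$. Then: (i) $M$ is scalar-flat ($\tau=0$ everywhere) if and only if $a=-1$. (ii) $M$ is Ricci-symmetric ($\nabla\rho=0$) if and only if it is an Einstein manifold. (iii) The Ricci tensor is $\eta$-parallel, i.e. $(\nabla_x\rho)(y,z)=0$ for all $x,y,z\in\ker\eta$, and parallel along $\xi$, i.e. $\nabla_\xi\rho=0$. (iv) $M$ is $\eta$-Einstein if and only if $\operatorname{Div}Q\in\ker\eta$ at every point. (v) $M$ is Einstein if and only if $\operatorname{Div}Q\in\ker\eta$ and $\operatorname{Div}^*Q\in\ker\eta$ at every point. -/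

import Mathlib

open Bundle FiberBundle VectorField Module
open scoped Manifold ContDiff Topology

noncomputable section

section Metric

/-- A smooth pseudo-Riemannian metric on a smooth manifold `M` modelled on `E`. -/
structure PseudoRiemannianMetric {E : Type*} [NormedAddCommGroup E] [NormedSpace ℝ E]
    {H : Type*} [TopologicalSpace H] (I : ModelWithCorners ℝ E H)
    (M : Type*) [TopologicalSpace M] [ChartedSpace H M] [IsManifold I ∞ M] where
  val : Π p : M, TangentSpace I p →L[ℝ] TangentSpace I p →L[ℝ] ℝ
  symm : ∀ (p : M) (x y : TangentSpace I p), val p x y = val p y x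
  nondegenerate : ∀ (p : M) (x : TangentSpace I p), (∀ y, val p x y = 0) → x = 0
  contMDiff : ContMDiff I (I.prod 𝓘(ℝ, E →L[ℝ] E →L[ℝ] ℝ)) ∞
    (fun p ↦ TotalSpace.mk' (E →L[ℝ] E →L[ℝ] ℝ) p (val p))

variable {E : Type*} [NormedAddCommGroup E] [NormedSpace ℝ E]
  {H : Type*} [TopologicalSpace H] {I : ModelWithCorners ℝ E H}
  {M : Type*} [TopologicalSpace M] [ChartedSpace H M] [IsManifold I ∞ M]

namespace PseudoRiemannianMetric

variable (g : PseudoRiemannianMetric I M)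

/-- The function `g(X, Y)` for vector fields `X`, `Y`. -/
def pair (X Y : Π p : M, TangentSpace I p) (p : M) : ℝ := g.val p (X p) (Y p)

/-- The Koszul expression, which equals `g(∇_X Y, Z)` for the Levi-Civita connection `∇` of `g`. -/
def koszul (X Y Z : Π p : M, TangentSpace I p) (p : M) : ℝ :=
  (1 / 2 : ℝ) * (d% (g.pair Y Z) p (X p) + d% (g.pair Z X) p (Y p) - d% (g.pair X Y) p (Z p)
    + g.val p (mlieBracket I X Y p) (Z p) - g.val p (mlieBracket I Y Z p) (X p)
    + g.val p (mlieBracket I Z X p) (Y p))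

variable {X X' Y Y' Z Z' : Π p : M, TangentSpace I p} {p : M}

theorem mdifferentiableAt_pair (hX : MDiffAt (T% X) p) (hY : MDiffAt (T% Y) p) :
    MDiffAt (g.pair X Y) p := by
  have h1 : MDifferentiableAt I
    (I.prod 𝓘(ℝ, E →L[ℝ] E →L[ℝ] ℝ))
    (fun p ↦ TotalSpace.mk' (E →L[ℝ] E →L[ℝ] ℝ)
      p (g.val p)) p := g.contMDiff.contMDiffAt.mdifferentiableAt (by simp)
  have h2 : MDifferentiableAt I (I.prod 𝓘(ℝ))
      (fun q ↦ TotalSpace.mk' ℝ (E := Bundle.Trivial M ℝ) q (g.val q (X q) (Y q))) p :=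
    MDifferentiableAt.clm_bundle_apply₂ (F₁ := E)
      (F₂ := E) h1 hX hY
  simp only [mdifferentiableAt_totalSpace] at h2
  exact h2.2

theorem pair_comm : g.pair X Y = g.pair Y X := funext fun p ↦ g.symm p _ _

theorem pair_add_left : g.pair (X + X') Y = g.pair X Y + g.pair X' Y := by
  funext q; simp [pair]

theorem pair_smul_left (f : M → ℝ) : g.pair (f • X) Y = f * g.pair X Y := by
  funext q; simp [pair]

theorem pair_add_right : g.pair X (Y + Y') = g.pair X Y + g.pair X Y' := by
  funext q; simp [pair]

theorem pair_smul_right (f : M → ℝ) : g.pair X (f • Y) = f * g.pair X Y := by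
  funext q; simp [pair]

theorem eq_of_val_eq {x y : TangentSpace I p} (h : ∀ z, g.val p x z = g.val p y z) : x = y := by
  rw [← sub_eq_zero]
  apply g.nondegenerate
  intro z
  simp [h]

section Flat

variable [FiniteDimensional ℝ E]

instance finiteDimensional_tangentSpace (p : M) : FiniteDimensional ℝ (TangentSpace I p) :=
  inferInstanceAs (FiniteDimensional ℝ E)

instance t2Space_tangentSpace (p : M) : T2Space (TangentSpace I p) :=
  inferInstanceAs (T2Space E)

/-- The musical isomorphism `x ↦ g(x, ·)`. -/
def flat (p : M) : TangentSpace I p ≃ₗ[ℝ] (TangentSpace I p →L[ℝ] ℝ) :=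
  (LinearEquiv.ofInjectiveOfFinrankEq
    (LinearMap.toContinuousLinearMap.symm.toLinearMap ∘ₗ (g.val p).toLinearMap)
    (by
      rw [injective_iff_map_eq_zero]
      intro x hx
      exact g.nondegenerate p x fun y ↦ congrArg (fun l : TangentSpace I p →ₗ[ℝ] ℝ ↦ l y) hx)
    Subspace.dual_finrank_eq.symm).trans LinearMap.toContinuousLinearMap

theorem flat_apply (p : M) (x y : TangentSpace I p) : g.flat p x y = g.val p x y := rfl

end Flat

variable [CompleteSpace E]

theorem koszul_tensorial_left (hY : MDiffAt (T% Y) p) (hZ : MDiffAt (T% Z) p) :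
    TensorialAt I (E) (fun X ↦ g.koszul X Y Z p) p where
  smul {f X} hf hX := by
    simp only [koszul, pair_smul_left, pair_smul_right,
      mvfderiv_mul hf (g.mdifferentiableAt_pair hX hY),
      mvfderiv_mul hf (g.mdifferentiableAt_pair hZ hX),
      mlieBracket_smul_left hf hX, mlieBracket_smul_right hf hX]
    simp [pair, g.symm p (X p)]
    ring
  add {X X'} hX hX' := by
    simp only [koszul, pair_add_left, pair_add_right,
      mvfderiv_add (g.mdifferentiableAt_pair hX hY) (g.mdifferentiableAt_pair hX' hY),
      mvfderiv_add (g.mdifferentiableAt_pair hZ hX) (g.mdifferentiableAt_pair hZ hX'),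
      mlieBracket_add_left hX hX', mlieBracket_add_right hX hX']
    simp
    ring

theorem koszul_tensorial_right (hX : MDiffAt (T% X) p) (hY : MDiffAt (T% Y) p) :
    TensorialAt I (E) (fun Z ↦ g.koszul X Y Z p) p where
  smul {f Z} hf hZ := by
    simp only [koszul, pair_smul_left, pair_smul_right,
      mvfderiv_mul hf (g.mdifferentiableAt_pair hY hZ),
      mvfderiv_mul hf (g.mdifferentiableAt_pair hZ hX),
      mlieBracket_smul_left hf hZ, mlieBracket_smul_right hf hZ]
    simp [pair, g.symm p (Z p)]
    ring
  add {Z Z'} hZ hZ' := by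
    simp only [koszul, pair_add_left, pair_add_right,
      mvfderiv_add (g.mdifferentiableAt_pair hY hZ) (g.mdifferentiableAt_pair hY hZ'),
      mvfderiv_add (g.mdifferentiableAt_pair hZ hX) (g.mdifferentiableAt_pair hZ' hX),
      mlieBracket_add_left hZ hZ', mlieBracket_add_right hZ hZ']
    simp
    ring

theorem koszul_smul_mid {f : M → ℝ} (hf : MDiffAt f p) (hX : MDiffAt (T% X) p)
    (hY : MDiffAt (T% Y) p) (hZ : MDiffAt (T% Z) p) :
    g.koszul X (f • Y) Z p = f p * g.koszul X Y Z p + d% f p (X p) * g.val p (Y p) (Z p) := by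
  simp only [koszul, pair_smul_left, pair_smul_right,
    mvfderiv_mul hf (g.mdifferentiableAt_pair hY hZ),
    mvfderiv_mul hf (g.mdifferentiableAt_pair hX hY),
    mlieBracket_smul_left hf hY, mlieBracket_smul_right hf hY]
  simp [pair, g.symm p (Y p)]
  ring

theorem koszul_add_mid (hX : MDiffAt (T% X) p)
    (hY : MDiffAt (T% Y) p) (hY' : MDiffAt (T% Y') p) (hZ : MDiffAt (T% Z) p) :
    g.koszul X (Y + Y') Z p = g.koszul X Y Z p + g.koszul X Y' Z p := by
  simp only [koszul, pair_add_left, pair_add_right,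
    mvfderiv_add (g.mdifferentiableAt_pair hY hZ) (g.mdifferentiableAt_pair hY' hZ),
    mvfderiv_add (g.mdifferentiableAt_pair hX hY) (g.mdifferentiableAt_pair hX hY'),
    mlieBracket_add_left hY hY', mlieBracket_add_right hY hY']
  simp
  ring

variable [FiniteDimensional ℝ E]

open Classical in
/-- For a vector field `Y` that is differentiable at `p`, the endomorphism `x ↦ ∇_x Y` of the
tangent space at `p`, determined by Koszul's formula. -/
def leviCivitaFun (Y : Π p : M, TangentSpace I p) (p : M) :
    TangentSpace I p →L[ℝ] TangentSpace I p :=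
  if hY : MDiffAt (T% Y) p then
    LinearMap.toContinuousLinearMap ((g.flat p).symm.toLinearMap ∘ₗ
      (TensorialAt.mkHom₂ (fun X Z ↦ g.koszul X Y Z p) p
        (fun _ hZ ↦ g.koszul_tensorial_left hY hZ)
        (fun _ hX ↦ g.koszul_tensorial_right hX hY)).toLinearMap)
  else 0

theorem val_leviCivitaFun (hX : MDiffAt (T% X) p) (hY : MDiffAt (T% Y) p)
    (hZ : MDiffAt (T% Z) p) :
    g.val p (g.leviCivitaFun Y p (X p)) (Z p) = g.koszul X Y Z p := by
  rw [leviCivitaFun, dif_pos hY, ← g.flat_apply]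
  simp only [LinearMap.coe_toContinuousLinearMap', LinearMap.comp_apply, LinearEquiv.coe_coe,
    LinearEquiv.apply_symm_apply]
  exact TensorialAt.mkHom₂_apply _ _ hX hZ

/-- The Levi-Civita connection of a pseudo-Riemannian metric: `g.leviCivita Y p x` is the covariant
derivative `∇_x Y` at `p`. -/
def leviCivita : CovariantDerivative I E (TangentSpace I : M → Type _) where
  toFun := g.leviCivitaFun
  isCovariantDerivativeOnUniv :=
    { add := by
        intro Y Y' p hY hY' _
        ext x
        apply g.eq_of_val_eq
        intro z
        have hx := mdifferentiableAt_extend I E x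
        have hz := mdifferentiableAt_extend I E z
        have e1 := g.val_leviCivitaFun hx (mdifferentiableAt_add_section hY hY') hz
        have e2 := g.val_leviCivitaFun hx hY hz
        have e3 := g.val_leviCivitaFun hx hY' hz
        rw [g.koszul_add_mid hx hY hY' hz] at e1
        simp only [extend_apply_self] at e1 e2 e3
        simp [e1, e2, e3]
      leibniz := by
        intro Y f p hY hf _
        ext x
        apply g.eq_of_val_eq
        intro z
        have hx := mdifferentiableAt_extend I E x
        have hz := mdifferentiableAt_extend I E z
        have e1 := g.val_leviCivitaFun hx (hf.smul_section hY) hz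
        have e2 := g.val_leviCivitaFun hx hY hz
        rw [g.koszul_smul_mid hf hx hY hz] at e1
        simp only [extend_apply_self] at e1 e2
        simp [e1, e2] }

theorem val_leviCivita (hX : MDiffAt (T% X) p) (hY : MDiffAt (T% Y) p)
    (hZ : MDiffAt (T% Z) p) :
    g.val p (g.leviCivita Y p (X p)) (Z p) = g.koszul X Y Z p :=
  g.val_leviCivitaFun hX hY hZ

theorem leviCivita_torsion : g.leviCivita.torsion = 0 := by
  rw [CovariantDerivative.torsion_eq_zero_iff]
  intro X Y p hX hY
  apply g.eq_of_val_eq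
  intro z
  have hz := mdifferentiableAt_extend I E z
  have e1 := g.val_leviCivita hX hY hz
  have e2 := g.val_leviCivita hY hX hz
  simp only [koszul, extend_apply_self] at e1 e2
  rw [g.pair_comm (X := extend E z) (Y := X), mlieBracket_swap_apply (V := extend E z) (W := X),
    g.pair_comm (X := X) (Y := Y)] at e1
  rw [g.pair_comm (X := extend E z) (Y := Y), mlieBracket_swap_apply (V := extend E z) (W := Y),
    mlieBracket_swap_apply (V := Y) (W := X)] at e2
  simp only [map_sub, sub_apply, e1, e2]
  simp
  ring

theorem leviCivita_metric (hX : MDiffAt (T% X) p) (hY : MDiffAt (T% Y) p)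
    (hZ : MDiffAt (T% Z) p) :
    d% (g.pair Y Z) p (X p) =
      g.val p (g.leviCivita Y p (X p)) (Z p) + g.val p (Y p) (g.leviCivita Z p (X p)) := by
  rw [g.symm p (Y p), g.val_leviCivita hX hY hZ, g.val_leviCivita hX hZ hY]
  simp only [koszul]
  rw [g.pair_comm (X := Z) (Y := X), g.pair_comm (X := Z) (Y := Y), g.pair_comm (X := Y) (Y := X),
    mlieBracket_swap_apply (V := Z) (W := X), mlieBracket_swap_apply (V := Z) (W := Y),
    mlieBracket_swap_apply (V := Y) (W := X)]
  simp
  ring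

end PseudoRiemannianMetric

end Metric

section Curvature

variable {E : Type*} [NormedAddCommGroup E] [NormedSpace ℝ E] [CompleteSpace E]
  [FiniteDimensional ℝ E]
  {H : Type*} [TopologicalSpace H] {I : ModelWithCorners ℝ E H}
  {M : Type*} [TopologicalSpace M] [ChartedSpace H M] [IsManifold I ∞ M]

/-- The contraction `h^{ij} B(e_i, e_j)` of a bilinear map `B` with respect to a nondegenerate
symmetric bilinear form `h`, where `(e_i)` is a basis and `(h^{ij})` is the inverse of the matrix
`(h(e_i, e_j))`. -/
def metricTrace {V W : Type*} [AddCommGroup V] [Module ℝ V] [FiniteDimensional ℝ V]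
    [AddCommGroup W] [Module ℝ W] (h : V → V → ℝ) (B : V → V → W) : W :=
  ∑ i, ∑ j, (Matrix.of fun i j ↦ h (finBasis ℝ V i) (finBasis ℝ V j))⁻¹ i j •
    B (finBasis ℝ V i) (finBasis ℝ V j)

namespace PseudoRiemannianMetric

variable (g : PseudoRiemannianMetric I M)

/-- The vector field `∇_X Y`. -/
def nabla (X Y : Π p : M, TangentSpace I p) (p : M) : TangentSpace I p :=
  g.leviCivita Y p (X p)

/-- The curvature `R(x, y)z = ∇_X ∇_Y Z - ∇_Y ∇_X Z - ∇_[X, Y] Z`, where `X`, `Y`, `Z` are vector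
fields which are smooth near `p` and have the values `x`, `y`, `z` at `p`. -/
def curvature (p : M) (x y z : TangentSpace I p) : TangentSpace I p :=
  g.nabla (extend E x) (g.nabla (extend E y) (extend E z)) p
    - g.nabla (extend E y) (g.nabla (extend E x) (extend E z)) p
    - g.nabla (mlieBracket I (extend E x) (extend E y)) (extend E z) p

/-- The Ricci tensor `ρ(y, z)`, the trace of `x ↦ R(x, y)z`. -/
def ricci (p : M) (y z : TangentSpace I p) : ℝ :=
  ∑ i, (finBasis ℝ (TangentSpace I p)).coord i
    (g.curvature p (finBasis ℝ (TangentSpace I p) i) y z)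

/-- The scalar curvature `τ = g^{ij} ρ(e_i, e_j)`. -/
def scalarCurvature (p : M) : ℝ :=
  metricTrace (fun x y ↦ g.val p x y) (g.ricci p)

/-- The Ricci operator `Qx = g^{ij} ρ(x, e_i) e_j`, that is `g(Qx, y) = ρ(x, y)`. -/
def ricciOperator (p : M) (x : TangentSpace I p) : TangentSpace I p :=
  metricTrace (fun u v ↦ g.val p u v) (fun u v ↦ g.ricci p x u • v)

/-- The covariant derivative of a field `A` of endomorphisms,
`(∇_x A)y = ∇_x (A Y) - A (∇_x Y)` for `Y` smooth near `p` with the value `y` at `p`. -/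
def covDerivEnd (A : Π p : M, TangentSpace I p → TangentSpace I p) (p : M)
    (x y : TangentSpace I p) : TangentSpace I p :=
  g.leviCivita (fun q ↦ A q (extend E y q)) p x - A p (g.leviCivita (extend E y) p x)

/-- The covariant derivative of a `(0,2)`-tensor field `T`,
`(∇_x T)(y, z) = x (T(Y, Z)) - T(∇_x Y, z) - T(y, ∇_x Z)` for `Y`, `Z` smooth near `p` with the
values `y`, `z` at `p`. -/
def covDerivForm (T : Π p : M, TangentSpace I p → TangentSpace I p → ℝ) (p : M)
    (x y z : TangentSpace I p) : ℝ :=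
  d% (fun q ↦ T q (extend E y q) (extend E z q)) p x
    - T p (g.leviCivita (extend E y) p x) z - T p y (g.leviCivita (extend E z) p x)

/-- The manifold is Ricci-symmetric: `∇ρ = 0`. -/
def IsRicciSymmetric : Prop :=
  ∀ (p : M) (x y z : TangentSpace I p), g.covDerivForm g.ricci p x y z = 0

/-- The scalar curvature vanishes identically. -/
def IsScalarFlat : Prop := ∀ p : M, g.scalarCurvature p = 0

end PseudoRiemannianMetric

end Curvature

section BMetric

/-- An almost contact B-metric manifold `(M, φ, ξ, η, g)` of dimension `2n + 1`. -/
structure AlmostContactBMetric (n : ℕ) (M : Type*) [TopologicalSpace M]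
    [ChartedSpace (EuclideanSpace ℝ (Fin (2 * n + 1))) M] [IsManifold (𝓡 (2 * n + 1)) ∞ M] where
  /-- the B-metric -/
  g : PseudoRiemannianMetric (𝓡 (2 * n + 1)) M
  /-- the field of endomorphisms of the tangent bundle -/
  φ : Π p : M, TangentSpace (𝓡 (2 * n + 1)) p →L[ℝ] TangentSpace (𝓡 (2 * n + 1)) p
  /-- the Reeb vector field -/
  ξ : Π p : M, TangentSpace (𝓡 (2 * n + 1)) p
  /-- the contact 1-form -/
  η : Π p : M, TangentSpace (𝓡 (2 * n + 1)) p →L[ℝ] ℝ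
  contMDiff_φ : ContMDiff (𝓡 (2 * n + 1)) ((𝓡 (2 * n + 1)).prod
      𝓘(ℝ, EuclideanSpace ℝ (Fin (2 * n + 1)) →L[ℝ] EuclideanSpace ℝ (Fin (2 * n + 1)))) ∞
    (fun p ↦ TotalSpace.mk'
      (EuclideanSpace ℝ (Fin (2 * n + 1)) →L[ℝ] EuclideanSpace ℝ (Fin (2 * n + 1))) p (φ p))
  contMDiff_ξ : ContMDiff (𝓡 (2 * n + 1))
    ((𝓡 (2 * n + 1)).prod 𝓘(ℝ, EuclideanSpace ℝ (Fin (2 * n + 1)))) ∞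
    (fun p ↦ TotalSpace.mk' (EuclideanSpace ℝ (Fin (2 * n + 1))) p (ξ p))
  contMDiff_η : ContMDiff (𝓡 (2 * n + 1))
    ((𝓡 (2 * n + 1)).prod 𝓘(ℝ, EuclideanSpace ℝ (Fin (2 * n + 1)) →L[ℝ] ℝ)) ∞
    (fun p ↦ TotalSpace.mk' (EuclideanSpace ℝ (Fin (2 * n + 1)) →L[ℝ] ℝ) p (η p))
  φ_ξ : ∀ p, φ p (ξ p) = 0
  φ_φ : ∀ p x, φ p (φ p x) = -x + η p x • ξ p
  η_φ : ∀ p x, η p (φ p x) = 0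
  η_ξ : ∀ p, η p (ξ p) = 1
  g_φ_φ : ∀ p x y, g.val p (φ p x) (φ p y) = -g.val p x y + η p x * η p y
  /-- `g` has signature `(n + 1, n)` -/
  signature : ∀ p, ∃ e : Basis (Fin (n + 1) ⊕ Fin n) ℝ (TangentSpace (𝓡 (2 * n + 1)) p),
    ∀ i j, g.val p (e i) (e j) = if i = j then Sum.elim (fun _ ↦ 1) (fun _ ↦ -1) i else 0

variable {n : ℕ} {M : Type*} [TopologicalSpace M]
  [ChartedSpace (EuclideanSpace ℝ (Fin (2 * n + 1))) M] [IsManifold (𝓡 (2 * n + 1)) ∞ M]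

namespace AlmostContactBMetric

variable (S : AlmostContactBMetric n M)

/-- The associated metric `g̃(x, y) = g(x, φy) + η(x)η(y)`. -/
def assocMetric (p : M) (x y : TangentSpace (𝓡 (2 * n + 1)) p) : ℝ :=
  S.g.val p x (S.φ p y) + S.η p x * S.η p y

/-- Sasaki-like: `(∇_x φ)y = -g(x, y)ξ - η(y)x + 2η(x)η(y)ξ`. -/
def IsSasakiLike : Prop :=
  ∀ (p : M) (x y : TangentSpace (𝓡 (2 * n + 1)) p),
    S.g.covDerivEnd (fun q v ↦ S.φ q v) p x y =
      -(S.g.val p x y) • S.ξ p - S.η p y • x + (2 * S.η p x * S.η p y) • S.ξ p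

/-- Einstein-like with the constants `(a, b, c)`: `ρ = a g + b g̃ + c η ⊗ η`. -/
def IsEinsteinLike (a b c : ℝ) : Prop :=
  ∀ (p : M) (x y : TangentSpace (𝓡 (2 * n + 1)) p),
    S.g.ricci p x y = a * S.g.val p x y + b * S.assocMetric p x y + c * (S.η p x * S.η p y)

/-- `η`-Einstein: `ρ = a g + c η ⊗ η` for some constants `a`, `c`. -/
def IsEtaEinstein : Prop := ∃ a c : ℝ, S.IsEinsteinLike a 0 c

/-- Einstein: `ρ = a g` for some constant `a`. -/
def IsEinstein : Prop := ∃ a : ℝ, S.IsEinsteinLike a 0 0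

/-- The Ricci tensor is `η`-parallel: `∇ρ` vanishes on the contact distribution `ker η`. -/
def IsRicciEtaParallel : Prop :=
  ∀ (p : M) (x y z : TangentSpace (𝓡 (2 * n + 1)) p), S.η p x = 0 → S.η p y = 0 → S.η p z = 0 →
    S.g.covDerivForm S.g.ricci p x y z = 0

/-- The Ricci tensor is parallel along `ξ`: `∇_ξ ρ = 0`. -/
def IsRicciParallelAlongReeb : Prop :=
  ∀ (p : M) (y z : TangentSpace (𝓡 (2 * n + 1)) p),
    S.g.covDerivForm S.g.ricci p (S.ξ p) y z = 0

/-- The divergence of the Ricci operator with respect to `g`, the vector field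
`g^{ij} (∇_{e_i} Q) e_j`. -/
def divQ (p : M) : TangentSpace (𝓡 (2 * n + 1)) p :=
  metricTrace (fun x y ↦ S.g.val p x y) (S.g.covDerivEnd S.g.ricciOperator p)

/-- The divergence of the Ricci operator with respect to `g̃`, the vector field
`g̃^{ij} (∇_{e_i} Q) e_j`; here `∇` and `Q` still belong to `g`. -/
def divStarQ (p : M) : TangentSpace (𝓡 (2 * n + 1)) p :=
  metricTrace (S.assocMetric p) (S.g.covDerivEnd S.g.ricciOperator p)

end AlmostContactBMetric

end BMetric

end

/-! Differentiating `φ ξ = 0` with the Sasaki-like formula gives `∇_x ξ = -φ x`, hence `R(x, y)ξ =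
η(y)x - η(x)y` and `ρ(ξ, ξ) = 2n`. For an Einstein-like `ρ` this forces `a + b + c = 2n`. Since `tr
φ = 0`, the scalar curvature `a(2n + 1) + b + c` becomes `2n(a + 1)`, which gives (i).

As `∇g = 0`, only `∇φ` and `∇η` contribute to `∇ρ`, and they give an explicit tensor whose
coefficients are `b` and `b + c` (`IsEinsteinLike.covDerivForm_ricci`). Each of its terms carries a
factor `η(y)` or `η(z)`, and it vanishes for `x = ξ`: this is (iii). Both `(∇_x ρ)(y, ξ)` and
`η((∇_x Q)y)` equal the form `divForm`, whose trace is `-2nb` with respect to `g` and `-2n(b + c)`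
with respect to `g̃`. So these two numbers are `η(Div Q)` and `η(Div* Q)`; the first detects `b =
0`, and together they detect `b = c = 0`. Hence (ii), (iv) and (v).

The analytic input is that `R(x, y)z`, defined through chosen extensions, may be computed with the
field `ξ` itself in the last slot (`curvatureField_congr`). -/

noncomputable section

/-! ### Contractions with a nondegenerate form, and traces. -/

section LinearAlgebra

variable {V : Type*} [AddCommGroup V] [Module ℝ V]

theorem gram_det_ne_zero {ι : Type*} [Fintype ι] [DecidableEq ι] (h : LinearMap.BilinForm ℝ V)
    (hnd : ∀ x, (∀ y, h x y = 0) → x = 0) (e : Basis ι ℝ V) :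
    (Matrix.of fun i j ↦ h (e i) (e j)).det ≠ 0 := by
  intro h0
  obtain ⟨c, hc, hc0⟩ := Matrix.exists_vecMul_eq_zero_iff.2 h0
  apply hc
  have h1 : ∑ i, c i • e i = 0 := by
    apply hnd
    intro y
    have : h (∑ i, c i • e i) = 0 := by
      refine e.ext fun k ↦ ?_
      have := congrFun hc0 k
      simpa [Matrix.vecMul, dotProduct] using this
    rw [this]; rfl
  exact funext (Fintype.linearIndependent_iff.1 e.linearIndependent c h1)

variable [FiniteDimensional ℝ V]

/-- The family `e` is not assumed to be a basis: a nonzero Gram determinant and the right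
cardinality make it one. This suits a local frame, known to be a basis only where its determinant is
nonzero. -/
theorem sum_inv_gram_smul {ι : Type*} [Fintype ι] [DecidableEq ι] (h : LinearMap.BilinForm ℝ V)
    (hnd : ∀ x, (∀ y, h x y = 0) → x = 0) (e : ι → V)
    (hdet : (Matrix.of fun i j ↦ h (e i) (e j)).det ≠ 0)
    (hcard : Fintype.card ι = finrank ℝ V) (w : V) :
    ∑ i, ∑ j, (Matrix.of fun i j ↦ h (e i) (e j))⁻¹ i j • h w (e i) • e j = w := by
  set G := Matrix.of fun i j ↦ h (e i) (e j) with hG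
  have hG' : IsUnit G.det := isUnit_iff_ne_zero.2 hdet
  have hli : LinearIndependent ℝ e := by
    rw [Fintype.linearIndependent_iff]
    intro c hc
    have h1 : Matrix.vecMul c G = 0 := by
      funext k
      have := congrArg (fun v ↦ h v (e k)) hc
      simpa [Matrix.vecMul, dotProduct, hG] using this
    have h2 := Matrix.eq_zero_of_vecMul_eq_zero hdet h1
    exact fun i ↦ congrFun h2 i
  let b := Basis.mk hli (hli.span_eq_top_of_card_eq_finrank' hcard).ge
  have hb : ∀ i, b i = e i := fun i ↦ by simp [b]
  rw [← sub_eq_zero]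
  apply hnd
  intro y
  have key : h (∑ i, ∑ j, G⁻¹ i j • h w (e i) • e j - w) = 0 := by
    refine b.ext fun k ↦ ?_
    have h3 : ∀ i, ∑ j, G⁻¹ i j * h (e j) (e k) = (1 : Matrix ι ι ℝ) i k := by
      intro i
      rw [← Matrix.nonsing_inv_mul G hG', Matrix.mul_apply]
      simp [hG]
    simp only [hb, map_sub, map_sum, map_smul, LinearMap.sub_apply, LinearMap.sum_apply,
      LinearMap.smul_apply, smul_eq_mul, LinearMap.zero_apply]
    rw [sub_eq_zero]
    calc ∑ i, ∑ j, G⁻¹ i j * (h w (e i) * h (e j) (e k))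
        = ∑ i, h w (e i) * ∑ j, G⁻¹ i j * h (e j) (e k) := by
          refine Finset.sum_congr rfl fun i _ ↦ ?_
          rw [Finset.mul_sum]
          exact Finset.sum_congr rfl fun j _ ↦ by ring
      _ = h w (e k) := by simp [h3, Matrix.one_apply]
  rw [key]; rfl

theorem metricTrace_smul_eq (h : LinearMap.BilinForm ℝ V)
    (hnd : ∀ x, (∀ y, h x y = 0) → x = 0) (w : V) :
    metricTrace (fun x y ↦ h x y) (fun u v ↦ h w u • v) = w :=
  sum_inv_gram_smul h hnd _ (gram_det_ne_zero h hnd _) (by simp) w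

/-- The coordinates of `T e_k` are read off from the expansion in `sum_inv_gram_smul`; symmetry of
`h` transposes the inverse Gram matrix. -/
theorem metricTrace_apply_eq_trace (h : LinearMap.BilinForm ℝ V)
    (hsymm : ∀ x y, h x y = h y x) (hnd : ∀ x, (∀ y, h x y = 0) → x = 0) (T : V →ₗ[ℝ] V) :
    metricTrace (fun x y ↦ h x y) (fun u v ↦ h (T u) v) = LinearMap.trace ℝ V T := by
  classical
  rw [LinearMap.trace_eq_matrix_trace ℝ (finBasis ℝ V), Matrix.trace]
  simp only [Matrix.diag_apply, LinearMap.toMatrix_apply]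
  unfold metricTrace
  have hs : ∀ i j, (Matrix.of fun i j ↦ h (finBasis ℝ V i) (finBasis ℝ V j))⁻¹ i j =
      (Matrix.of fun i j ↦ h (finBasis ℝ V i) (finBasis ℝ V j))⁻¹ j i := by
    intro i j
    have hT : (Matrix.of fun i j ↦ h (finBasis ℝ V i) (finBasis ℝ V j)).transpose =
        Matrix.of fun i j ↦ h (finBasis ℝ V i) (finBasis ℝ V j) := by
      ext i j
      exact hsymm _ _
    conv_lhs => rw [← hT, ← Matrix.transpose_nonsing_inv, Matrix.transpose_apply]
  refine Finset.sum_congr rfl fun k _ ↦ ?_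
  conv_rhs => rw [← sum_inv_gram_smul h hnd (finBasis ℝ V) (gram_det_ne_zero h hnd _) (by simp)
    (T (finBasis ℝ V k))]
  simp only [map_sum, map_smul, Finsupp.coe_finsetSum, Finset.sum_apply, Finsupp.smul_apply,
    Basis.repr_self, smul_eq_mul, Finsupp.single_apply]
  refine Finset.sum_congr rfl fun i _ ↦ ?_
  rw [hs k i]
  simp

theorem map_metricTrace {W W' : Type*} [AddCommGroup W] [Module ℝ W] [AddCommGroup W']
    [Module ℝ W'] (h : V → V → ℝ) (B : V → V → W) (L : W →ₗ[ℝ] W') :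
    L (metricTrace h B) = metricTrace h (fun u v ↦ L (B u v)) := by
  simp [metricTrace, map_sum]

/-- Over `ℂ` every eigenvalue is a root of `r³ + r`, so it is `0` or `±i`. The trace is real and is
a sum of purely imaginary numbers. -/
theorem trace_eq_zero_of_cube_eq_neg (T : V →ₗ[ℝ] V) (hT : ∀ x, T (T (T x)) = -T x) :
    LinearMap.trace ℝ V T = 0 := by
  classical
  set A := LinearMap.toMatrix (finBasis ℝ V) (finBasis ℝ V) T with hA
  have hA3 : A ^ 3 + A = 0 := by
    have : T * T * T = -T := LinearMap.ext fun x ↦ hT x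
    rw [pow_succ, pow_two, hA, ← LinearMap.toMatrix_mul, ← LinearMap.toMatrix_mul, this]
    simp
  set B : Matrix _ _ ℂ := A.map (algebraMap ℝ ℂ) with hB
  have hB3 : B ^ 3 + B = 0 := by
    have := congrArg (algebraMap ℝ ℂ).mapMatrix hA3
    simpa only [map_add, map_pow, map_zero, RingHom.mapMatrix_apply] using this
  rw [LinearMap.trace_eq_matrix_trace ℝ (finBasis ℝ V), ← hA]
  have h1 : ((A.trace : ℝ) : ℂ) = B.charpoly.roots.sum := by
    rw [← Matrix.trace_eq_sum_roots_charpoly]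
    simp [hB, Matrix.trace]
  have h2 : ∀ r ∈ B.charpoly.roots, r.re = 0 := by
    intro r hr
    have hr1 : r ∈ spectrum ℂ B :=
      Matrix.mem_spectrum_of_isRoot_charpoly (Polynomial.isRoot_of_mem_roots hr)
    have hr2 := spectrum.subset_polynomial_aeval B (Polynomial.X ^ 3 + Polynomial.X)
      ⟨r, hr1, rfl⟩
    have h0 : Polynomial.aeval B (Polynomial.X ^ 3 + Polynomial.X : Polynomial ℂ) = 0 := by
      simpa using hB3
    have hr3 : r ^ 3 + r = 0 := by
      rw [h0] at hr2
      by_contra hne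
      rw [spectrum.mem_iff] at hr2
      apply hr2
      simp only [Polynomial.eval_add, Polynomial.eval_pow, Polynomial.eval_X, sub_zero]
      exact (isUnit_iff_ne_zero.2 hne).map (algebraMap ℂ _)
    have hr4 : r = 0 ∨ r ^ 2 = -1 := by
      rcases mul_eq_zero.1 (show r * (r ^ 2 + 1) = 0 by rw [← hr3]; ring) with h | h
      · exact Or.inl h
      · exact Or.inr (eq_neg_of_add_eq_zero_left h)
    rcases hr4 with rfl | h
    · simp
    · have hI : r ^ 2 = Complex.I ^ 2 := by rw [h, Complex.I_sq]
      rcases sq_eq_sq_iff_eq_or_eq_neg.1 hI with rfl | rfl <;> simp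
  have h3 : (B.charpoly.roots.sum).re = 0 := by
    generalize B.charpoly.roots = s at h2
    induction s using Multiset.induction_on with
    | empty => simp
    | cons a s ih =>
      rw [Multiset.sum_cons, Complex.add_re, h2 a (Multiset.mem_cons_self _ _),
        ih fun r hr ↦ h2 r (Multiset.mem_cons_of_mem hr), add_zero]
  rw [← h1] at h3
  simpa using h3

end LinearAlgebra

/-! ### Smoothness of covariant derivatives, and tensoriality of the curvature. -/

section Smoothness

variable {E : Type*} [NormedAddCommGroup E] [NormedSpace ℝ E]
  {H : Type*} [TopologicalSpace H] {I : ModelWithCorners ℝ E H}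
  {M : Type*} [TopologicalSpace M] [ChartedSpace H M]

theorem Filter.EventuallyEq.mvfderiv_eq {f f' : M → ℝ} {p : M} (h : f =ᶠ[𝓝 p] f') :
    d% f p = d% f' p := by
  ext v
  have hp : f p = f' p := h.self_of_nhds
  have := h.mfderiv_eq (I := I) (I' := 𝓘(ℝ))
  simp only [mvfderiv, this, ContinuousLinearMap.comp_apply]
  rfl

theorem contMDiffAt_det {n : Type*} [Fintype n] [DecidableEq n] {A : M → Matrix n n ℝ} {p : M}
    (hA : ∀ i j, CMDiffAt ∞ (fun q ↦ A q i j) p) : CMDiffAt ∞ (fun q ↦ (A q).det) p := by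
  simp only [Matrix.det_apply']
  exact contMDiffAt_finsetSum fun σ _ ↦
    contMDiffAt_const.mul (contMDiffAt_finsetProd fun i _ ↦ hA _ _)

theorem contMDiffAt_inv_matrix {n : Type*} [Fintype n] [DecidableEq n] {A : M → Matrix n n ℝ}
    {p : M} (hA : ∀ i j, CMDiffAt ∞ (fun q ↦ A q i j) p) (hdet : (A p).det ≠ 0) (i j : n) :
    CMDiffAt ∞ (fun q ↦ (A q)⁻¹ i j) p := by
  simp only [Matrix.inv_def, Matrix.smul_apply, Ring.inverse_eq_inv', smul_eq_mul,
    Matrix.adjugate_apply]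
  refine ((contMDiffAt_det hA).inv₀ hdet).mul (contMDiffAt_det fun k l ↦ ?_)
  -- An adjugate entry is the determinant of `A` with row `j` replaced by a constant row.
  by_cases hk : k = j
  · subst hk
    simpa using contMDiffAt_const
  · simpa [Matrix.updateRow_ne hk] using hA k l

variable [IsManifold I ∞ M]

theorem contMDiffAt_eventually_mdifferentiableAt {X : Π p : M, TangentSpace I p} {p : M}
    (hX : CMDiffAt ∞ (T% X) p) : ∀ᶠ q in 𝓝 p, MDiffAt (T% X) q := by
  have h : CMDiffAt 1 (T% X) p := hX.of_le (by simp)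
  filter_upwards [(contMDiffAt_iff_contMDiffAt_nhds (by simp)).1 h] with q hq
  exact hq.mdifferentiableAt (by simp)

theorem contMDiffAt_eventually_mdifferentiableAt_fun {f : M → ℝ} {p : M}
    (hf : CMDiffAt ∞ f p) : ∀ᶠ q in 𝓝 p, MDiffAt f q := by
  have h : CMDiffAt 1 f p := hf.of_le (by simp)
  filter_upwards [(contMDiffAt_iff_contMDiffAt_nhds (by simp)).1 h] with q hq
  exact hq.mdifferentiableAt (by simp)

theorem minSmoothness_natCast_le (k : ℕ) : minSmoothness ℝ k ≤ ∞ := by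
  rw [minSmoothness_of_isRCLikeNormedField]
  exact_mod_cast (le_top : (k : ℕ∞) ≤ ⊤)

theorem isManifold_minSmoothness (k : ℕ) : IsManifold I (minSmoothness ℝ k) M :=
  IsManifold.of_le (minSmoothness_natCast_le k)

theorem contMDiffAt_mlieBracket [CompleteSpace E] {X Y : Π p : M, TangentSpace I p} {p : M}
    (hX : CMDiffAt ∞ (T% X) p) (hY : CMDiffAt ∞ (T% Y) p) :
    CMDiffAt ∞ (T% (mlieBracket I X Y)) p := by
  have : IsManifold I (((⊤ : ℕ∞) : WithTop ℕ∞) + 1) M := by simpa using! ‹IsManifold I ∞ M›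
  have : IsManifold I (minSmoothness ℝ 2) M := isManifold_minSmoothness 2
  exact ContMDiffAt.mlieBracket_vectorField (m := ⊤) (n := ⊤) hX hY (by simp)

variable (I) in
/-- The vector field `X` is differentiable at `p`. -/
abbrev MDifferentiableFieldAt (X : Π p : M, TangentSpace I p) (p : M) : Prop := MDiffAt (T% X) p

variable (I) in
/-- The vector field `X` is smooth at `p`. -/
abbrev SmoothFieldAt (X : Π p : M, TangentSpace I p) (p : M) : Prop := CMDiffAt ∞ (T% X) p

variable (g : PseudoRiemannianMetric I M)

namespace PseudoRiemannianMetric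

theorem contMDiffAt_pair {X Y : Π p : M, TangentSpace I p} {p : M}
    (hX : CMDiffAt ∞ (T% X) p) (hY : CMDiffAt ∞ (T% Y) p) : CMDiffAt ∞ (g.pair X Y) p := by
  have h2 : ContMDiffAt I (I.prod 𝓘(ℝ)) ∞
      (fun q ↦ TotalSpace.mk' ℝ (E := Bundle.Trivial M ℝ) q (g.val q (X q) (Y q))) p :=
    ContMDiffAt.clm_bundle_apply₂ (F₁ := E) (F₂ := E) g.contMDiff.contMDiffAt hX hY
  simp only [contMDiffAt_totalSpace] at h2
  exact h2.2

/-- The metric at a point as a bilinear form. -/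
def bilin (p : M) : LinearMap.BilinForm ℝ (TangentSpace I p) :=
  LinearMap.mk₂ ℝ (fun x y ↦ g.val p x y) (by simp) (by simp) (by simp) (by simp)

/-- A vector field whose metric pairings with smooth vector fields are smooth is smooth. -/
theorem contMDiffAt_of_pair [FiniteDimensional ℝ E] {U : Π p : M, TangentSpace I p} {p : M}
    (hU : ∀ z : TangentSpace I p, CMDiffAt ∞ (g.pair U (extend E z)) p) :
    CMDiffAt ∞ (T% U) p := by
  classical
  set b := finBasis ℝ (TangentSpace I p)
  let e : Fin (finrank ℝ (TangentSpace I p)) → Π q : M, TangentSpace I q := fun i ↦ extend E (b i)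
  have he : ∀ i, CMDiffAt ∞ (T% (e i)) p := fun i ↦ contMDiffAt_extend I E (b i)
  let G : M → Matrix (Fin (finrank ℝ (TangentSpace I p))) (Fin (finrank ℝ (TangentSpace I p))) ℝ :=
    fun q ↦ Matrix.of fun i j ↦ g.bilin q (e i q) (e j q)
  have hG : ∀ i j, CMDiffAt ∞ (fun q ↦ G q i j) p := fun i j ↦ g.contMDiffAt_pair (he i) (he j)
  -- The extended basis of the tangent space at `p` remains a frame as long as this determinant is
  -- nonzero, so near `p` the field `U` is recovered from its pairings with the frame.
  have hdet : (G p).det ≠ 0 := by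
    have := gram_det_ne_zero (g.bilin p) (g.nondegenerate p) b
    simpa [G, e] using this
  have hsum : CMDiffAt ∞ (T% (fun q ↦ ∑ i, ∑ j, ((G q)⁻¹ i j * g.pair U (e i) q) • e j q)) p :=
    ContMDiffAt.sum_section fun i _ ↦ ContMDiffAt.sum_section fun j _ ↦
      ((contMDiffAt_inv_matrix hG hdet i j).mul (hU (b i))).smul_section (he j)
  refine hsum.congr_of_eventuallyEq ?_
  filter_upwards [(contMDiffAt_det hG).continuousAt.eventually_ne hdet] with q hq
  have := sum_inv_gram_smul (g.bilin q) (g.nondegenerate q) (fun i ↦ e i q) hq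
    (by rw [Fintype.card_fin]; rfl) (U q)
  congr 1
  rw [← this]
  simp only [mul_smul]
  rfl

variable [CompleteSpace E]

/-- Brackets of smooth fields are smooth and `[X, fW] - f[X, W] = (Xf)W`. Pairing with `Z`, where
`g(W, Z) ≠ 0`, and dividing isolates `Xf`. -/
theorem contMDiffAt_mvfderiv_apply (g : PseudoRiemannianMetric I M) {f : M → ℝ} {X : Π p : M, TangentSpace I p} {p : M}
    (hf : CMDiffAt ∞ f p) (hX : CMDiffAt ∞ (T% X) p) :
    CMDiffAt ∞ (fun q ↦ d% f q (X q)) p := by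
  by_cases hE : ∃ w : TangentSpace I p, w ≠ 0
  swap
  · push Not at hE
    have hz (v : E) : v = 0 := hE v
    have : (fun q ↦ d% f q (X q)) = fun _ ↦ 0 := by
      funext q
      have : X q = 0 := hz (X q)
      rw [this, map_zero]
    rw [this]
    exact contMDiffAt_const
  obtain ⟨w, hw⟩ := hE
  obtain ⟨z, hz⟩ : ∃ z, g.val p w z ≠ 0 := by
    by_contra! h
    exact hw (g.nondegenerate p w h)
  have hW : CMDiffAt ∞ (T% (extend E w)) p := contMDiffAt_extend I E w
  have hZ : CMDiffAt ∞ (T% (extend E z)) p := contMDiffAt_extend I E z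
  have h1 : CMDiffAt ∞ (T% (mlieBracket I X (f • extend E w))) p :=
    contMDiffAt_mlieBracket hX (hf.smul_section hW)
  have h2 : CMDiffAt ∞ (T% (mlieBracket I X (extend E w))) p := contMDiffAt_mlieBracket hX hW
  have hne : g.pair (extend E w) (extend E z) p ≠ 0 := by simpa [pair] using hz
  have h3 := ((g.contMDiffAt_pair h1 hZ).sub (hf.mul (g.contMDiffAt_pair h2 hZ))).mul
    ((g.contMDiffAt_pair hW hZ).inv₀ hne)
  refine h3.congr_of_eventuallyEq ?_
  filter_upwards [contMDiffAt_eventually_mdifferentiableAt hW,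
    contMDiffAt_eventually_mdifferentiableAt_fun hf,
    (g.contMDiffAt_pair hW hZ).continuousAt.eventually_ne hne] with q hq1 hq2 hq3
  simp only [pair] at hq3
  simp only [pair, mlieBracket_smul_right hq2 hq1, map_add, map_smul, add_apply,
    smul_apply, smul_eq_mul, Pi.mul_apply]
  field_simp
  ring

/-- Obtained from the Jacobi identity for `X`, `Y`, `fW`: after subtracting `f` times the identity
for `X`, `Y`, `W`, what remains is the claimed equation multiplied by `W`. -/
theorem mvfderiv_mlieBracket (g : PseudoRiemannianMetric I M) {f : M → ℝ} {X Y : Π p : M, TangentSpace I p} {p : M}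
    (hf : CMDiffAt ∞ f p) (hX : CMDiffAt ∞ (T% X) p) (hY : CMDiffAt ∞ (T% Y) p) :
    d% f p (mlieBracket I X Y p) =
      d% (fun q ↦ d% f q (Y q)) p (X p) - d% (fun q ↦ d% f q (X q)) p (Y p) := by
  by_cases hE : ∃ w : TangentSpace I p, w ≠ 0
  swap
  · push Not at hE
    simp [hE (mlieBracket I X Y p), hE (X p), hE (Y p)]
  obtain ⟨w, hw⟩ := hE
  have : IsManifold I (minSmoothness ℝ 3) M := isManifold_minSmoothness 3
  have h2 : minSmoothness ℝ 2 ≤ ∞ := minSmoothness_natCast_le 2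
  set W : Π p : M, TangentSpace I p := extend E w with hWdef
  have hWp : W p = w := by simp [W]
  have hW : CMDiffAt ∞ (T% W) p := contMDiffAt_extend I E w
  have expand : ∀ {Z : Π p : M, TangentSpace I p} (_ : CMDiffAt ∞ (T% Z) p),
      mlieBracket I Z (f • W) =ᶠ[𝓝 p]
        (fun q ↦ d% f q (Z q)) • W + f • mlieBracket I Z W := by
    intro Z hZ
    filter_upwards [contMDiffAt_eventually_mdifferentiableAt hW,
      contMDiffAt_eventually_mdifferentiableAt_fun hf] with q hq1 hq2
    exact mlieBracket_smul_right hq2 hq1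
  have twice : ∀ {U Z : Π p : M, TangentSpace I p} (_ : CMDiffAt ∞ (T% U) p)
      (_ : CMDiffAt ∞ (T% Z) p),
      mlieBracket I U (mlieBracket I Z (f • W)) p =
        d% (fun q ↦ d% f q (Z q)) p (U p) • w + d% f p (Z p) • mlieBracket I U W p
        + (d% f p (U p) • mlieBracket I Z W p + f p • mlieBracket I U (mlieBracket I Z W) p) := by
    intro U Z hU hZ
    have hZf := (g.contMDiffAt_mvfderiv_apply hf hZ).mdifferentiableAt (by simp)
    have hWd : MDiffAt (T% W) p := hW.mdifferentiableAt (by simp)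
    have hB : MDiffAt (T% (mlieBracket I Z W)) p :=
      (contMDiffAt_mlieBracket hZ hW).mdifferentiableAt (by simp)
    have hfd : MDiffAt f p := hf.mdifferentiableAt (by simp)
    rw [Filter.EventuallyEq.mlieBracket_vectorField_eq (Filter.EventuallyEq.refl _ U) (expand hZ),
      mlieBracket_add_right (hZf.smul_section hWd) (hfd.smul_section hB),
      mlieBracket_smul_right hZf hWd, mlieBracket_smul_right hfd hB, hWp]
  have jac := leibniz_identity_mlieBracket_apply (hX.of_le h2) (hY.of_le h2)
    ((hf.smul_section hW).of_le h2)
  have jacW := leibniz_identity_mlieBracket_apply (hX.of_le h2) (hY.of_le h2) (hW.of_le h2)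
  rw [twice hX hY, twice hY hX, mlieBracket_smul_right (hf.mdifferentiableAt (by simp))
    (hW.mdifferentiableAt (by simp)), jacW, hWp] at jac
  have : (d% f p (mlieBracket I X Y p) -
      (d% (fun q ↦ d% f q (Y q)) p (X p) - d% (fun q ↦ d% f q (X q)) p (Y p))) • w = 0 := by
    rw [← sub_eq_zero] at jac
    rw [← neg_eq_zero, ← jac]
    module
  exact sub_eq_zero.1 ((smul_eq_zero.1 this).resolve_right hw)

theorem contMDiffAt_koszul {X Y Z : Π p : M, TangentSpace I p} {p : M}
    (hX : CMDiffAt ∞ (T% X) p) (hY : CMDiffAt ∞ (T% Y) p) (hZ : CMDiffAt ∞ (T% Z) p) :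
    CMDiffAt ∞ (g.koszul X Y Z) p := by
  have h1 := g.contMDiffAt_mvfderiv_apply (g.contMDiffAt_pair hY hZ) hX
  have h2 := g.contMDiffAt_mvfderiv_apply (g.contMDiffAt_pair hZ hX) hY
  have h3 := g.contMDiffAt_mvfderiv_apply (g.contMDiffAt_pair hX hY) hZ
  have h4 := g.contMDiffAt_pair (contMDiffAt_mlieBracket hX hY) hZ
  have h5 := g.contMDiffAt_pair (contMDiffAt_mlieBracket hY hZ) hX
  have h6 := g.contMDiffAt_pair (contMDiffAt_mlieBracket hZ hX) hY
  exact contMDiffAt_const.mul (((((h1.add h2).sub h3).add h4).sub h5).add h6)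

variable [FiniteDimensional ℝ E]

/-- By Koszul's formula, the pairings of `∇_X Y` with smooth fields are smooth functions. -/
theorem contMDiffAt_nabla {X Y : Π p : M, TangentSpace I p} {p : M}
    (hX : CMDiffAt ∞ (T% X) p) (hY : CMDiffAt ∞ (T% Y) p) :
    CMDiffAt ∞ (T% (g.nabla X Y)) p := by
  refine g.contMDiffAt_of_pair fun z ↦ ?_
  have hZ : CMDiffAt ∞ (T% (extend E z)) p := contMDiffAt_extend I E z
  refine (g.contMDiffAt_koszul hX hY hZ).congr_of_eventuallyEq ?_
  filter_upwards [contMDiffAt_eventually_mdifferentiableAt hX,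
    contMDiffAt_eventually_mdifferentiableAt hY,
    contMDiffAt_eventually_mdifferentiableAt hZ] with q h1 h2 h3
  exact g.val_leviCivita h1 h2 h3

/-- The curvature expression `∇_X ∇_Y Z - ∇_Y ∇_X Z - ∇_[X, Y] Z` on vector fields. -/
def curvatureField (X Y Z : Π p : M, TangentSpace I p) (p : M) : TangentSpace I p :=
  g.nabla X (g.nabla Y Z) p - g.nabla Y (g.nabla X Z) p - g.nabla (mlieBracket I X Y) Z p

theorem mvfderiv_mvfderiv_pair {X Y V W : Π p : M, TangentSpace I p} {p : M}
    (hX : CMDiffAt ∞ (T% X) p) (hY : CMDiffAt ∞ (T% Y) p)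
    (hV : CMDiffAt ∞ (T% V) p) (hW : CMDiffAt ∞ (T% W) p) :
    d% (fun q ↦ d% (g.pair V W) q (Y q)) p (X p) =
      g.val p (g.nabla X (g.nabla Y V) p) (W p) + g.val p (g.nabla Y V p) (g.nabla X W p)
      + (g.val p (g.nabla X V p) (g.nabla Y W p) + g.val p (V p) (g.nabla X (g.nabla Y W) p)) := by
  have hXd : MDiffAt (T% X) p := hX.mdifferentiableAt (by simp)
  have hVd : MDiffAt (T% V) p := hV.mdifferentiableAt (by simp)
  have hWd : MDiffAt (T% W) p := hW.mdifferentiableAt (by simp)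
  have hYV : MDiffAt (T% (g.nabla Y V)) p :=
    (g.contMDiffAt_nabla hY hV).mdifferentiableAt (by simp)
  have hYW : MDiffAt (T% (g.nabla Y W)) p :=
    (g.contMDiffAt_nabla hY hW).mdifferentiableAt (by simp)
  have hev : (fun q ↦ d% (g.pair V W) q (Y q)) =ᶠ[𝓝 p]
      g.pair (g.nabla Y V) W + g.pair V (g.nabla Y W) := by
    filter_upwards [contMDiffAt_eventually_mdifferentiableAt hY,
      contMDiffAt_eventually_mdifferentiableAt hV,
      contMDiffAt_eventually_mdifferentiableAt hW] with q h1 h2 h3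
    exact g.leviCivita_metric h1 h2 h3
  have hd : d% (fun q ↦ d% (g.pair V W) q (Y q)) p =
      d% (g.pair (g.nabla Y V) W + g.pair V (g.nabla Y W)) p := by
    exact hev.mvfderiv_eq
  rw [hd, mvfderiv_add (g.mdifferentiableAt_pair hYV hWd) (g.mdifferentiableAt_pair hVd hYW),
    add_apply, g.leviCivita_metric hXd hYV hWd, g.leviCivita_metric hXd hVd hYW]
  rfl

/-- Apply the operator `XY - YX - [X, Y]` to the function `g(V, W)`. It gives zero, and metric
compatibility makes the mixed terms `g(∇V, ∇W)` cancel. -/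
theorem val_curvatureField_skew {X Y V W : Π p : M, TangentSpace I p} {p : M}
    (hX : CMDiffAt ∞ (T% X) p) (hY : CMDiffAt ∞ (T% Y) p)
    (hV : CMDiffAt ∞ (T% V) p) (hW : CMDiffAt ∞ (T% W) p) :
    g.val p (g.curvatureField X Y V p) (W p) = -g.val p (V p) (g.curvatureField X Y W p) := by
  have h1 := g.mvfderiv_mlieBracket (g.contMDiffAt_pair hV hW) hX hY
  rw [g.mvfderiv_mvfderiv_pair hX hY hV hW, g.mvfderiv_mvfderiv_pair hY hX hV hW,
    g.leviCivita_metric ((contMDiffAt_mlieBracket hX hY).mdifferentiableAt (by simp))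
      (hV.mdifferentiableAt (by simp)) (hW.mdifferentiableAt (by simp))] at h1
  simp only [curvatureField, map_sub, sub_apply]
  simp only [nabla] at h1 ⊢
  linarith

/-- The curvature is tensorial in its last argument. -/
theorem curvatureField_congr {X Y V V' : Π p : M, TangentSpace I p} {p : M}
    (hX : CMDiffAt ∞ (T% X) p) (hY : CMDiffAt ∞ (T% Y) p)
    (hV : CMDiffAt ∞ (T% V) p) (hV' : CMDiffAt ∞ (T% V') p) (h : V p = V' p) :
    g.curvatureField X Y V p = g.curvatureField X Y V' p := by
  apply g.eq_of_val_eq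
  intro z
  have hZ : CMDiffAt ∞ (T% (extend E z)) p := contMDiffAt_extend I E z
  -- Skew-symmetry moves the derivatives from `V` to the test field, so only the value of `V` at `p`
  -- remains.
  have e1 := g.val_curvatureField_skew hX hY hV hZ
  have e2 := g.val_curvatureField_skew hX hY hV' hZ
  simp only [extend_apply_self] at e1 e2
  rw [e1, e2, h]

end PseudoRiemannianMetric

end Smoothness

namespace AlmostContactBMetric

variable {n : ℕ} {M : Type*} [TopologicalSpace M]
  [ChartedSpace (EuclideanSpace ℝ (Fin (2 * n + 1))) M] [IsManifold (𝓡 (2 * n + 1)) ∞ M]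
  (S : AlmostContactBMetric n M)

/-! ### Algebra of the structure on one tangent space. -/

section Pointwise

variable (p : M) (x y : TangentSpace (𝓡 (2 * n + 1)) p)

theorem val_ξ_right : S.g.val p x (S.ξ p) = S.η p x := by
  have h := S.g_φ_φ p x (S.ξ p)
  rw [S.φ_ξ, S.η_ξ, map_zero] at h
  linarith

theorem val_ξ_left : S.g.val p (S.ξ p) x = S.η p x := by
  rw [S.g.symm, val_ξ_right]

theorem val_φ_left : S.g.val p (S.φ p x) y = S.g.val p x (S.φ p y) := by
  have h := S.g_φ_φ p x (S.φ p y)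
  rw [S.φ_φ, S.η_φ, map_add, map_neg, map_smul, val_ξ_right, S.η_φ] at h
  simp at h
  linarith

theorem assocMetric_symm : S.assocMetric p x y = S.assocMetric p y x := by
  simp only [assocMetric]
  rw [← val_φ_left, S.g.symm, mul_comm (S.η p x)]

/-- Testing against `ξ` gives `η(x) = 0`; nondegeneracy of `g` then gives `φ x = 0`, and `φ²`
recovers `x`. -/
theorem assocMetric_nondegenerate (h : ∀ y, S.assocMetric p x y = 0) : x = 0 := by
  have h1 : S.η p x = 0 := by simpa [assocMetric, S.φ_ξ, S.η_ξ] using h (S.ξ p)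
  have h2 : S.φ p x = 0 := by
    apply S.g.nondegenerate
    intro y
    have := h y
    rwa [assocMetric, h1, zero_mul, add_zero, ← val_φ_left] at this
  have h3 := S.φ_φ p x
  rw [h2, h1, map_zero, zero_smul, add_zero] at h3
  exact neg_eq_zero.1 h3.symm

/-- The associated metric at a point as a bilinear form. -/
def assocBilin : LinearMap.BilinForm ℝ (TangentSpace (𝓡 (2 * n + 1)) p) :=
  LinearMap.mk₂ ℝ (S.assocMetric p) (by intros; simp [assocMetric]; ring)
    (by intros; simp [assocMetric]; ring) (by intros; simp [assocMetric]; ring)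
    (by intros; simp [assocMetric]; ring)

/-- The endomorphism `u x + v φ x + w η(x) ξ`. -/
def basicEnd (u v w : ℝ) :
    TangentSpace (𝓡 (2 * n + 1)) p →ₗ[ℝ] TangentSpace (𝓡 (2 * n + 1)) p :=
  u • LinearMap.id + v • (S.φ p).toLinearMap + w • (S.η p).toLinearMap.smulRight (S.ξ p)

theorem basicEnd_apply (u v w : ℝ) :
    S.basicEnd p u v w x = u • x + v • S.φ p x + w • S.η p x • S.ξ p := rfl

/-- The identities for `φ² ` and `φ ξ` give `φ³ = -φ`. -/
theorem trace_φ : LinearMap.trace ℝ _ (S.φ p).toLinearMap = 0 := by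
  apply trace_eq_zero_of_cube_eq_neg
  intro x
  simp [S.φ_φ, S.φ_ξ]

theorem trace_basicEnd (u v w : ℝ) :
    LinearMap.trace ℝ _ (S.basicEnd p u v w) = u * (2 * n + 1) + w := by
  rw [basicEnd, map_add, map_add, map_smul, map_smul, map_smul, trace_φ, LinearMap.trace_id,
    show finrank ℝ (TangentSpace (𝓡 (2 * n + 1)) p) = 2 * n + 1 from finrank_euclideanSpace_fin,
    LinearMap.trace_smulRight]
  simp [S.η_ξ]

theorem metricTrace_val_basicEnd (u v w : ℝ) :
    metricTrace (fun x y ↦ S.g.val p x y) (fun x y ↦ S.g.val p (S.basicEnd p u v w x) y) =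
      u * (2 * n + 1) + w := by
  rw [← S.trace_basicEnd p]
  exact metricTrace_apply_eq_trace (S.g.bilin p) (S.g.symm p) (S.g.nondegenerate p) _

theorem metricTrace_assocMetric_basicEnd (u v w : ℝ) :
    metricTrace (S.assocMetric p) (fun x y ↦ S.assocMetric p (S.basicEnd p u v w x) y) =
      u * (2 * n + 1) + w := by
  rw [← S.trace_basicEnd p]
  exact metricTrace_apply_eq_trace (S.assocBilin p) (S.assocMetric_symm p)
    (S.assocMetric_nondegenerate p) _

/-- The bilinear form `b (-g + η ⊗ η) - (b + c) g(φ ·, ·)`. -/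
def divForm (b c : ℝ) : ℝ :=
  b * (-S.g.val p x y + S.η p x * S.η p y) - (b + c) * S.g.val p (S.φ p x) y

theorem metricTrace_val_divForm (b c : ℝ) :
    metricTrace (fun x y ↦ S.g.val p x y) (fun x y ↦ S.divForm p x y b c) = -(2 * n * b) := by
  have h : (fun x y ↦ S.divForm p x y b c) =
      fun x y ↦ S.g.val p (S.basicEnd p (-b) (-(b + c)) b x) y := by
    funext x y
    simp [divForm, basicEnd_apply, val_ξ_left]
    ring
  rw [h, metricTrace_val_basicEnd]
  ring

/-- Expressing the form through `g̃` amounts to composing with `φ`, which exchanges the roles of `g`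
and `g(φ ·, ·)`. Since `φ` is traceless, this trace sees `b + c` where the `g`-trace sees `b`. -/
theorem metricTrace_assocMetric_divForm (b c : ℝ) :
    metricTrace (S.assocMetric p) (fun x y ↦ S.divForm p x y b c) = -(2 * n * (b + c)) := by
  have h : (fun x y ↦ S.divForm p x y b c) =
      fun x y ↦ S.assocMetric p (S.basicEnd p (-(b + c)) b (b + c) x) y := by
    funext x y
    rw [assocMetric, ← val_φ_left]
    simp [divForm, basicEnd_apply, val_ξ_left, S.φ_φ, S.φ_ξ, S.η_ξ, S.η_φ]
    ring
  rw [h, metricTrace_assocMetric_basicEnd]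
  ring

end Pointwise

/-! ### Sasaki-like structures: derivatives of `φ`, `ξ`, and the curvature on `ξ`. -/

section Sasaki

variable {p : M} {X Y : Π q : M, TangentSpace (𝓡 (2 * n + 1)) q}

theorem mdifferentiableAt_φ_apply (hY : MDifferentiableFieldAt (𝓡 (2 * n + 1)) Y p) :
    MDifferentiableFieldAt (𝓡 (2 * n + 1)) (fun q ↦ S.φ q (Y q)) p :=
  MDifferentiableAt.clm_bundle_apply (S.contMDiff_φ.contMDiffAt.mdifferentiableAt (by simp)) hY

theorem mdifferentiableAt_ξ : MDifferentiableFieldAt (𝓡 (2 * n + 1)) S.ξ p :=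
  S.contMDiff_ξ.contMDiffAt.mdifferentiableAt (by simp)

/-- Allows the Sasaki-like condition, formulated with canonical extensions, to be used for any
differentiable field, in particular `ξ` itself. -/
theorem tensorialAt_covDeriv_φ (x : TangentSpace (𝓡 (2 * n + 1)) p) :
    TensorialAt (𝓡 (2 * n + 1)) (EuclideanSpace ℝ (Fin (2 * n + 1)))
      (fun Y ↦ S.g.leviCivita (fun q ↦ S.φ q (Y q)) p x - S.φ p (S.g.leviCivita Y p x)) p where
  smul {f Y} hf hY := by
    have h1 : (fun q ↦ S.φ q ((f • Y) q)) = f • fun q ↦ S.φ q (Y q) := by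
      funext q
      simp
    rw [h1, S.g.leviCivita.isCovariantDerivativeOnUniv.leibniz (S.mdifferentiableAt_φ_apply hY) hf,
      S.g.leviCivita.isCovariantDerivativeOnUniv.leibniz hY hf]
    simp [smul_sub]
  add {Y Y'} hY hY' := by
    have h1 : (fun q ↦ S.φ q ((Y + Y') q)) = (fun q ↦ S.φ q (Y q)) + fun q ↦ S.φ q (Y' q) := by
      funext q
      simp
    rw [h1, S.g.leviCivita.isCovariantDerivativeOnUniv.add (S.mdifferentiableAt_φ_apply hY)
      (S.mdifferentiableAt_φ_apply hY'), S.g.leviCivita.isCovariantDerivativeOnUniv.add hY hY']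
    simp
    abel

variable {S}

theorem IsSasakiLike.leviCivita_φ_apply (hS : S.IsSasakiLike) (hY : MDifferentiableFieldAt (𝓡 (2 * n + 1)) Y p)
    (x : TangentSpace (𝓡 (2 * n + 1)) p) :
    S.g.leviCivita (fun q ↦ S.φ q (Y q)) p x = S.φ p (S.g.leviCivita Y p x) +
      (-(S.g.val p x (Y p)) • S.ξ p - S.η p (Y p) • x + (2 * S.η p x * S.η p (Y p)) • S.ξ p) := by
  rw [← hS p x (Y p), ← sub_eq_iff_eq_add']
  exact (S.tensorialAt_covDeriv_φ x).pointwise hY (mdifferentiableAt_extend _ _ _) (by simp)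

/-- Differentiate `g(ξ, ξ) = 1`. -/
theorem η_leviCivita_ξ (x : TangentSpace (𝓡 (2 * n + 1)) p) :
    S.η p (S.g.leviCivita S.ξ p x) = 0 := by
  have h := S.g.leviCivita_metric (mdifferentiableAt_extend _ _ x) S.mdifferentiableAt_ξ
    S.mdifferentiableAt_ξ
  have h1 : S.g.pair S.ξ S.ξ = fun _ ↦ 1 := by
    funext q
    rw [PseudoRiemannianMetric.pair, val_ξ_right, S.η_ξ]
  rw [h1, mvfderiv_const, val_ξ_right, val_ξ_left] at h
  simp at h
  linarith

/-- On a Sasaki-like manifold `∇_x ξ = -φ x`. -/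
theorem IsSasakiLike.leviCivita_ξ (hS : S.IsSasakiLike) (x : TangentSpace (𝓡 (2 * n + 1)) p) :
    S.g.leviCivita S.ξ p x = -S.φ p x := by
  have h := hS.leviCivita_φ_apply S.mdifferentiableAt_ξ x
  have h0 : (fun q ↦ S.φ q (S.ξ q)) = 0 := funext S.φ_ξ
  rw [h0, CovariantDerivative.zero, val_ξ_right, S.η_ξ] at h
  -- On `∇_x ξ`, which lies in `ker η`, `φ²` is `-Id`; so applying `φ` to the derivative of `φ ξ =
  -- 0` solves for `∇_x ξ`.
  have h1 := congrArg (S.φ p) h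
  simp only [map_add, map_sub, map_smul, S.φ_ξ, S.φ_φ, η_leviCivita_ξ] at h1
  simp at h1
  rw [← sub_eq_zero, ← neg_eq_zero, h1]
  abel

/-- With `∇ξ = -φ` and zero torsion, `R(x, y)ξ = (∇_y φ)x - (∇_x φ)y`, and the terms symmetric in
`x`, `y` cancel. -/
theorem IsSasakiLike.curvature_ξ (hS : S.IsSasakiLike) (x y : TangentSpace (𝓡 (2 * n + 1)) p) :
    S.g.curvature p x y (S.ξ p) = S.η p y • x - S.η p x • y := by
  set X : Π q : M, TangentSpace (𝓡 (2 * n + 1)) q :=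
    extend (EuclideanSpace ℝ (Fin (2 * n + 1))) x with hX
  set Y : Π q : M, TangentSpace (𝓡 (2 * n + 1)) q :=
    extend (EuclideanSpace ℝ (Fin (2 * n + 1))) y with hY
  have hXp : X p = x := by simp [X]
  have hYp : Y p = y := by simp [Y]
  have hXs : SmoothFieldAt (𝓡 (2 * n + 1)) X p := contMDiffAt_extend _ _ x
  have hYs : SmoothFieldAt (𝓡 (2 * n + 1)) Y p := contMDiffAt_extend _ _ y
  have hXd : MDifferentiableFieldAt (𝓡 (2 * n + 1)) X p := mdifferentiableAt_extend _ _ x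
  have hYd : MDifferentiableFieldAt (𝓡 (2 * n + 1)) Y p := mdifferentiableAt_extend _ _ y
  have h1 : S.g.curvature p x y (S.ξ p) = S.g.curvatureField X Y S.ξ p :=
    S.g.curvatureField_congr hXs hYs (contMDiffAt_extend _ _ _) S.contMDiff_ξ.contMDiffAt (by simp)
  have h2 (Z : Π q : M, TangentSpace (𝓡 (2 * n + 1)) q) :
      S.g.nabla Z S.ξ = (-1 : ℝ) • fun q ↦ S.φ q (Z q) := by
    funext q
    simp [PseudoRiemannianMetric.nabla, hS.leviCivita_ξ]
  have ht := (CovariantDerivative.torsion_eq_zero_iff _).1 S.g.leviCivita_torsion hXd hYd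
  have hc := S.g.leviCivita.isCovariantDerivativeOnUniv
  rw [h1, PseudoRiemannianMetric.curvatureField, h2, h2, h2]
  simp only [PseudoRiemannianMetric.nabla]
  rw [hc.smul_const _ (S.mdifferentiableAt_φ_apply hXd),
    hc.smul_const _ (S.mdifferentiableAt_φ_apply hYd)]
  simp only [smul_apply, Pi.smul_apply]
  rw [hS.leviCivita_φ_apply hXd, hS.leviCivita_φ_apply hYd, ← ht, map_sub, hXp, hYp,
    S.g.symm p y x]
  module

/-- This is the trace of `x ↦ x - η(x)ξ`, namely `(2n + 1) - 1`. -/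
theorem IsSasakiLike.ricci_ξ (hS : S.IsSasakiLike) (p : M) :
    S.g.ricci p (S.ξ p) (S.ξ p) = 2 * n := by
  simp only [PseudoRiemannianMetric.ricci, hS.curvature_ξ, S.η_ξ]
  set e := finBasis ℝ (TangentSpace (𝓡 (2 * n + 1)) p)
  have h : ∑ i, S.η p (e i) * e.repr (S.ξ p) i = 1 := by
    rw [← S.η_ξ p]
    conv_rhs => rw [← e.sum_repr (S.ξ p), map_sum]
    exact Finset.sum_congr rfl fun i _ ↦ by rw [map_smul, smul_eq_mul, mul_comm]
  have hd : finrank ℝ (TangentSpace (𝓡 (2 * n + 1)) p) = 2 * n + 1 := finrank_euclideanSpace_fin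
  simp [Finset.sum_sub_distrib, h, hd]

/-! ### Einstein-like Ricci tensors: scalar curvature, `∇ρ` and the two divergences. -/

variable {a b c : ℝ}

theorem IsEinsteinLike.add_eq (hE : S.IsEinsteinLike a b c) (hS : S.IsSasakiLike) (p : M) :
    a + b + c = 2 * n := by
  rw [← hS.ricci_ξ p, hE, assocMetric, val_ξ_right, S.φ_ξ, S.η_ξ]
  simp

theorem IsEinsteinLike.ricci_eq (hE : S.IsEinsteinLike a b c)
    (x y : TangentSpace (𝓡 (2 * n + 1)) p) :
    S.g.ricci p x y = S.g.val p (S.basicEnd p a b (b + c) x) y := by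
  rw [hE, assocMetric, ← val_φ_left]
  simp [basicEnd_apply, val_ξ_left]
  ring

theorem IsEinsteinLike.scalarCurvature_eq (hE : S.IsEinsteinLike a b c) (hS : S.IsSasakiLike)
    (p : M) : S.g.scalarCurvature p = 2 * n * (a + 1) := by
  have h : S.g.ricci p = fun x y ↦ S.g.val p (S.basicEnd p a b (b + c) x) y := by
    funext x y
    exact hE.ricci_eq x y
  rw [PseudoRiemannianMetric.scalarCurvature, h, metricTrace_val_basicEnd]
  linarith [hE.add_eq hS p]

theorem IsEinsteinLike.ricciOperator_eq (hE : S.IsEinsteinLike a b c)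
    (x : TangentSpace (𝓡 (2 * n + 1)) p) :
    S.g.ricciOperator p x = S.basicEnd p a b (b + c) x := by
  simp only [PseudoRiemannianMetric.ricciOperator, hE.ricci_eq]
  exact metricTrace_smul_eq (S.g.bilin p) (S.g.nondegenerate p) _

/-- Since `η = g(·, ξ)` and `∇ξ = -φ`, one has `(∇_x η)(y) = -g(φ x, y)`. -/
theorem IsSasakiLike.mvfderiv_η (hS : S.IsSasakiLike) (hY : MDifferentiableFieldAt (𝓡 (2 * n + 1)) Y p)
    (x : TangentSpace (𝓡 (2 * n + 1)) p) :
    mvfderiv (𝓡 (2 * n + 1)) (fun q ↦ S.η q (Y q)) p x = S.η p (S.g.leviCivita Y p x) - S.g.val p (S.φ p x) (Y p) := by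
  have h1 : (fun q ↦ S.η q (Y q)) = S.g.pair Y S.ξ := by
    funext q
    rw [PseudoRiemannianMetric.pair, val_ξ_right]
  have h := S.g.leviCivita_metric (mdifferentiableAt_extend _ _ x) hY S.mdifferentiableAt_ξ
  rw [h1]
  simp only [extend_apply_self] at h
  rw [h, hS.leviCivita_ξ, val_ξ_right, map_neg, S.g.symm p (Y p)]
  ring

theorem mdifferentiableAt_η_apply (hY : MDifferentiableFieldAt (𝓡 (2 * n + 1)) Y p) :
    MDifferentiableAt (𝓡 (2 * n + 1)) 𝓘(ℝ) (fun q ↦ S.η q (Y q)) p := by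
  have h1 : (fun q ↦ S.η q (Y q)) = S.g.pair Y S.ξ := by
    funext q
    rw [PseudoRiemannianMetric.pair, val_ξ_right]
  rw [h1]
  exact S.g.mdifferentiableAt_pair hY S.mdifferentiableAt_ξ

/-- Write `ρ = a g + b g(·, φ ·) + (b + c) η ⊗ η`. The first term is parallel, the second
contributes `b g(y, (∇_x φ)z)`, and the third contributes through `∇η`. -/
theorem IsEinsteinLike.covDerivForm_ricci (hE : S.IsEinsteinLike a b c) (hS : S.IsSasakiLike)
    (x y z : TangentSpace (𝓡 (2 * n + 1)) p) :
    S.g.covDerivForm S.g.ricci p x y z =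
      b * (-S.g.val p x y * S.η p z - S.g.val p x z * S.η p y
        + 2 * S.η p x * S.η p y * S.η p z)
      - (b + c) * (S.g.val p (S.φ p x) y * S.η p z + S.g.val p (S.φ p x) z * S.η p y) := by
  set Y : Π q : M, TangentSpace (𝓡 (2 * n + 1)) q :=
    extend (EuclideanSpace ℝ (Fin (2 * n + 1))) y with hY
  set Z : Π q : M, TangentSpace (𝓡 (2 * n + 1)) q :=
    extend (EuclideanSpace ℝ (Fin (2 * n + 1))) z with hZ
  have hYp : Y p = y := by simp [Y]
  have hZp : Z p = z := by simp [Z]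
  have hYd : MDifferentiableFieldAt (𝓡 (2 * n + 1)) Y p := mdifferentiableAt_extend _ _ y
  have hZd : MDifferentiableFieldAt (𝓡 (2 * n + 1)) Z p := mdifferentiableAt_extend _ _ z
  have hφZ := S.mdifferentiableAt_φ_apply hZd
  have hf : (fun q ↦ S.g.ricci q (Y q) (Z q)) =
      (fun _ ↦ a) * S.g.pair Y Z + (fun _ ↦ b) * S.g.pair Y (fun q ↦ S.φ q (Z q))
        + (fun _ ↦ b + c) * ((fun q ↦ S.η q (Y q)) * fun q ↦ S.η q (Z q)) := by
    funext q
    simp only [hE q, assocMetric, PseudoRiemannianMetric.pair, Pi.add_apply, Pi.mul_apply]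
    ring
  have d1 := S.g.mdifferentiableAt_pair hYd hZd
  have d2 := S.g.mdifferentiableAt_pair hYd hφZ
  have d3 := mdifferentiableAt_η_apply (S := S) hYd
  have d4 := mdifferentiableAt_η_apply (S := S) hZd
  have c1 : ∀ r : ℝ, MDifferentiableAt (𝓡 (2 * n + 1)) 𝓘(ℝ) (fun _ : M ↦ r) p :=
    fun r ↦ mdifferentiableAt_const
  have m1 := S.g.leviCivita_metric (mdifferentiableAt_extend _ _ x) hYd hZd
  have m2 := S.g.leviCivita_metric (mdifferentiableAt_extend _ _ x) hYd hφZ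
  simp only [extend_apply_self] at m1 m2
  rw [hS.leviCivita_φ_apply hZd] at m2
  rw [PseudoRiemannianMetric.covDerivForm, ← hY, ← hZ, hf,
    mvfderiv_add (((c1 a).mul d1).add ((c1 b).mul d2)) ((c1 _).mul (d3.mul d4)),
    mvfderiv_add ((c1 a).mul d1) ((c1 b).mul d2), mvfderiv_mul (c1 a) d1, mvfderiv_mul (c1 b) d2,
    mvfderiv_mul (c1 _) (d3.mul d4), mvfderiv_mul d3 d4]
  simp only [add_apply, smul_apply, mvfderiv_const, zero_apply, smul_eq_mul, m1, m2,
    hS.mvfderiv_η hYd, hS.mvfderiv_η hZd, hE p, assocMetric, hYp, hZp]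
  simp only [map_add, map_sub, map_smul, map_neg, neg_smul, val_ξ_right, smul_eq_mul,
    S.g.symm p y x]
  ring

theorem IsEinsteinLike.covDerivForm_ricci_ξ (hE : S.IsEinsteinLike a b c) (hS : S.IsSasakiLike)
    (x y : TangentSpace (𝓡 (2 * n + 1)) p) :
    S.g.covDerivForm S.g.ricci p x y (S.ξ p) = S.divForm p x y b c := by
  rw [hE.covDerivForm_ricci hS, divForm]
  simp only [val_ξ_right, S.η_ξ, S.η_φ]
  ring

/-- Only the `η`-component is needed, so `∇Q` is never computed in full. Differentiating `η(QY) = (a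
+ b + c) η(Y)` leaves `g(φ x, Q y) - (a + b + c) g(φ x, y)`. -/
theorem IsEinsteinLike.η_covDerivEnd_ricciOperator (hE : S.IsEinsteinLike a b c)
    (hS : S.IsSasakiLike) (x y : TangentSpace (𝓡 (2 * n + 1)) p) :
    S.η p (S.g.covDerivEnd S.g.ricciOperator p x y) = S.divForm p x y b c := by
  set Y : Π q : M, TangentSpace (𝓡 (2 * n + 1)) q :=
    extend (EuclideanSpace ℝ (Fin (2 * n + 1))) y with hY
  have hYp : Y p = y := by simp [Y]
  have hYd : MDifferentiableFieldAt (𝓡 (2 * n + 1)) Y p := mdifferentiableAt_extend _ _ y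
  have hQ : (fun q ↦ S.g.ricciOperator q (Y q)) =
      (a • Y + b • (fun q ↦ S.φ q (Y q))) + (fun q ↦ (b + c) * S.η q (Y q)) • S.ξ := by
    funext q
    simp [hE.ricciOperator_eq, basicEnd_apply, mul_smul]
  have hηQ (q : M) (v : TangentSpace (𝓡 (2 * n + 1)) q) :
      S.η q (S.g.ricciOperator q v) = (a + b + c) * S.η q v := by
    simp [hE.ricciOperator_eq, basicEnd_apply, S.η_φ, S.η_ξ]
    ring
  have d3 := mdifferentiableAt_η_apply (S := S) hYd
  have c1 : ∀ r : ℝ, MDifferentiableAt (𝓡 (2 * n + 1)) 𝓘(ℝ) (fun _ : M ↦ r) p :=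
    fun r ↦ mdifferentiableAt_const
  have hQd : MDifferentiableFieldAt (𝓡 (2 * n + 1)) (fun q ↦ S.g.ricciOperator q (Y q)) p := by
    rw [hQ]
    exact mdifferentiableAt_add_section (mdifferentiableAt_add_section
      ((c1 a).smul_section hYd) ((c1 b).smul_section (S.mdifferentiableAt_φ_apply hYd)))
      (((c1 (b + c)).mul d3).smul_section S.mdifferentiableAt_ξ)
  have h1 := hS.mvfderiv_η hQd x
  have h2 : (fun q ↦ S.η q (S.g.ricciOperator q (Y q))) =
      (fun _ ↦ (a + b + c)) * fun q ↦ S.η q (Y q) := funext fun q ↦ hηQ q _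
  rw [h2, mvfderiv_mul (c1 _) d3, mvfderiv_const, add_apply, smul_apply, smul_apply,
    hS.mvfderiv_η hYd, hYp, hE.ricciOperator_eq y, basicEnd_apply] at h1
  rw [PseudoRiemannianMetric.covDerivEnd, map_sub, hηQ, divForm]
  simp only [map_add, map_smul, S.g_φ_φ, val_ξ_right, S.η_φ, zero_apply, smul_eq_mul] at h1
  linarith

theorem IsEinsteinLike.η_divQ (hE : S.IsEinsteinLike a b c) (hS : S.IsSasakiLike) (p : M) :
    S.η p (S.divQ p) = -(2 * n * b) := by
  rw [divQ, ← metricTrace_val_divForm (S := S) (p := p) (c := c),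
    ← ContinuousLinearMap.coe_coe, map_metricTrace]
  simp only [ContinuousLinearMap.coe_coe, hE.η_covDerivEnd_ricciOperator hS]

theorem IsEinsteinLike.η_divStarQ (hE : S.IsEinsteinLike a b c) (hS : S.IsSasakiLike) (p : M) :
    S.η p (S.divStarQ p) = -(2 * n * (b + c)) := by
  rw [divStarQ, ← metricTrace_assocMetric_divForm (S := S) (p := p),
    ← ContinuousLinearMap.coe_coe, map_metricTrace]
  simp only [ContinuousLinearMap.coe_coe, hE.η_covDerivEnd_ricciOperator hS]

end Sasaki

end AlmostContactBMetric

end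

theorem mainTheorem7 {n : ℕ} (hn : 1 ≤ n) {M : Type*} [TopologicalSpace M]
    [ChartedSpace (EuclideanSpace ℝ (Fin (2 * n + 1))) M] [IsManifold (𝓡 (2 * n + 1)) ∞ M]
    [Nonempty M] (S : AlmostContactBMetric n M) (hS : S.IsSasakiLike)
    (a b c : ℝ) (hE : S.IsEinsteinLike a b c) :
    (S.g.IsScalarFlat ↔ a = -1) ∧
    (S.g.IsRicciSymmetric ↔ S.IsEinstein) ∧
    (S.IsRicciEtaParallel ∧ S.IsRicciParallelAlongReeb) ∧
    (S.IsEtaEinstein ↔ ∀ p : M, S.η p (S.divQ p) = 0) ∧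
    (S.IsEinstein ↔ ∀ p : M, S.η p (S.divQ p) = 0 ∧ S.η p (S.divStarQ p) = 0) := by
  have hn0 : (2 * n : ℝ) ≠ 0 := by positivity
  obtain ⟨p₀⟩ := ‹Nonempty M›
  have einstein (h1 : -(2 * n * b) = 0) (h2 : -(2 * n * (b + c)) = 0) : S.IsEinstein := by
    have hb : b = 0 := (mul_eq_zero.1 (neg_eq_zero.1 h1)).resolve_left hn0
    have hbc : b + c = 0 := (mul_eq_zero.1 (neg_eq_zero.1 h2)).resolve_left hn0
    have hc : c = 0 := by linarith
    subst hb hc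
    exact ⟨a, hE⟩
  refine ⟨⟨fun h ↦ ?_, fun h p ↦ ?_⟩, ⟨fun h ↦ ?_, ?_⟩, ⟨?_, ?_⟩, ⟨?_, fun h ↦ ?_⟩,
    ⟨?_, fun h ↦ ?_⟩⟩
  · have h0 := h p₀
    rw [hE.scalarCurvature_eq hS] at h0
    linarith [(mul_eq_zero.1 h0).resolve_left hn0]
  · rw [hE.scalarCurvature_eq hS, h]
    ring
  -- If `∇ρ = 0`, then `(∇_x ρ)(y, ξ)` vanishes, and so do both of its traces.
  · have h0 : (fun x y ↦ S.divForm p₀ x y b c) = fun _ _ ↦ 0 := by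
      funext x y
      rw [← hE.covDerivForm_ricci_ξ hS, h]
    refine einstein ?_ ?_
    · rw [← S.metricTrace_val_divForm p₀ b c, h0]
      simp [metricTrace]
    · rw [← S.metricTrace_assocMetric_divForm p₀ b c, h0]
      simp [metricTrace]
  -- The formulas hold for any admissible constants, so they apply to `(a', 0, 0)` directly;
  -- uniqueness of `(a, b, c)` is not needed.
  · rintro ⟨a', h'⟩ p x y z
    rw [h'.covDerivForm_ricci hS]
    ring
  · intro p x y z _ hy hz
    rw [hE.covDerivForm_ricci hS, hy, hz]
    ring
  · intro p y z
    -- With `x = ξ` the `b`-terms add up to `(-1 - 1 + 2) η(y)η(z)`, and the others contain `φ ξ =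
    -- 0`.
    rw [hE.covDerivForm_ricci hS, S.φ_ξ, S.η_ξ, S.val_ξ_left, S.val_ξ_left]
    simp
    ring_nf
    simp
  · rintro ⟨a', c', h'⟩ p
    rw [h'.η_divQ hS]
    ring
  · have h0 := h p₀
    rw [hE.η_divQ hS] at h0
    have hb : b = 0 := (mul_eq_zero.1 (neg_eq_zero.1 h0)).resolve_left hn0
    subst hb
    exact ⟨a, c, hE⟩
  · rintro ⟨a', h'⟩ p
    rw [h'.η_divQ hS, h'.η_divStarQ hS]
    constructor <;> ring
  · exact einstein (by rw [← hE.η_divQ hS p₀, (h p₀).1]) (by rw [← hE.η_divStarQ hS p₀, (h p₀).2])
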